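/- A digraph $D=(V,E)$ here has no loops and no parallel edges; $V$ may have any cardinality. For a finite set $X\subseteq V$, a strong component of $D-X$ is a maximal strongly connected set of vertices of $D-X$. The digraph $D$ is \emph{solid} if $D-X$ has only finitely many strong components for every finite $X\subseteq V$. \emph{Ends.} A ray is a one-way infinite directed path with a first vertex; its tails are its directed subrays. A ray is solid if, for every finite $X\subseteq V$, it has a tail in some strong component of $D-X$. Two solid rays are equivalent if, for every finite $X$, they have a tail in the same strong component of $D-X$. The ends of $D$ are the classes of this equivalence relation. For an end $\omega$ and a finite $X$, let $C(X,\omega)$ be the strong component of $D-X$ in which every ray representing $\omega$ has a tail; we say that $\omega$ lives in it. \emph{Limit edges.} For distinct ends $\omega,\eta$, the pair $(\omega,\eta)$ is a limit edge if $D$ has an edge from $C(X,\omega)$ to $C(X,\eta)$ for every finite $X$ with $C(X,\omega)\neq C(X,\eta)$. For a vertex $v$ and an end $\omega$, the pair $(v,\omega)$ (respectively $(\omega,v)$) is a limit edge if $D$ has an edge from $v$ to $C(X,\omega)$ (respectively from $C(X,\omega)$ to $v$) for every finite $X$ with $v\notin C(X,\omega)$. Let $\Omega$ be the set of ends and $\Lambda$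 the set of limit edges. \emph{The space $|D|$.} Take $V\cup\Omega$ together with a copy $[0,1]_e$ of the unit interval for every $e\in E\cup\Lambda$, and identify $0\in[0,1]_e$ with the tail of $e$ and $1\in[0,1]_e$ with its head. For a finite $X\subseteq V$ and a strong component $C$ of $D-X$, say that a vertex or end is \emph{in} $C$ if it is a vertex of $C$ or an end living in $C$. The topology $\textsc{DTop}$ on $|D|$ has the following basic open sets: \begin{itemize} \item for a vertex $v$ and $0<\varepsilon\le 1$: the star consisting of $v$ and of all inner points at distance less than $\varepsilon$ from $v$ on the edges and limit edges at $v$; \item for an edge $e\in E$: the open intervals $(z-\varepsilon,z+\varepsilon)\subseteq(0,1)_e$; \item for an end $\omega$, a finite $X$ and $0<\varepsilon\le1$, with $C=C(X,\omega)$: the set $\hat C_\varepsilon(X,\omega)$ of all vertices and ends in $C$, all inner points of edges and limit edges both of whose endpoints are in $C$, and all inner points of edges and limit edges at distance less than $\varepsilon$ from an endpoint that is in $C$; \item for a limit edge $(\omega,\eta)$ between ends, a finite $X$ with $C(X,\omega)\ne C(X,\eta)$, and $(z-\varepsilon,z+\varepsilon)\subseteq(0,1)$: the union of the intervals $(z-\varepsilon,z+\varepsilon)_e$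 over all $e\in E\cup\Lambda$ with tail in $C(X,\omega)$ and head in $C(X,\eta)$; \item for a limit edge $(v,\omega)$ with $v\in V$ and $\omega\in\Omega$, a finite $X$ with $v\in X$, and $(z-\varepsilon,z+\varepsilon)\subseteq(0,1)$: the union of the intervals $(z-\varepsilon,z+\varepsilon)_e$ over all $e\in E\cup\Lambda$ with tail $v$ and head in $C(X,\omega)$; and analogously, with tail in $C(X,\omega)$ and head $v$, for a limit edge $(\omega,v)$. \end{itemize} \textbf{Theorem.} For every digraph $D$, the space $|D|$ with the topology $\textsc{DTop}$ is compact if and only if $D$ is solid. -/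

import Mathlib

namespace Digraph

universe u

section StrongComponents

variable {V : Type u} (D : Digraph V)

/-- `w` can be reached from `v` by a directed path of `D - X` (possibly the trivial path). -/
def ReachAvoiding (X : Finset V) (v w : V) : Prop :=
  Relation.ReflTransGen (fun a b => a ∉ X ∧ b ∉ X ∧ D.Adj a b) v w

/-- The vertex set of the strong component of `D - X` that contains `v`, for `v ∉ X`.
It is empty if `v ∈ X`. -/
def strongComp (X : Finset V) (v : V) : Set V :=
  {w | v ∉ X ∧ w ∉ X ∧ D.ReachAvoiding X v w ∧ D.ReachAvoiding X w v}

/-- `C` is (the vertex set of) a strong component of `D - X`. -/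
def IsStrongComp (X : Finset V) (C : Set V) : Prop :=
  ∃ v, v ∉ X ∧ C = D.strongComp X v

/-- `D` is solid: `D - X` has only finitely many strong components for every finite vertex
set `X`. -/
def IsSolid : Prop :=
  ∀ X : Finset V, {C : Set V | D.IsStrongComp X C}.Finite

theorem strongComp_eq_of_mem {X : Finset V} {v w : V} (h : w ∈ D.strongComp X v) :
    D.strongComp X w = D.strongComp X v := by
  obtain ⟨hv, hw, hvw, hwv⟩ := h
  ext x
  constructor
  · rintro ⟨-, hx, h1, h2⟩
    exact ⟨hv, hx, hvw.trans h1, h2.trans hwv⟩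
  · rintro ⟨-, hx, h1, h2⟩
    exact ⟨hw, hx, hwv.trans h1, h2.trans hvw⟩

theorem IsStrongComp.eq_of_mem {X : Finset V} {C C' : Set V} {w : V}
    (hC : D.IsStrongComp X C) (hC' : D.IsStrongComp X C') (h : w ∈ C) (h' : w ∈ C') :
    C = C' := by
  obtain ⟨v, -, rfl⟩ := hC
  obtain ⟨v', -, rfl⟩ := hC'
  rw [← D.strongComp_eq_of_mem h, ← D.strongComp_eq_of_mem h']

end StrongComponents

section Ends

variable {V : Type u} (D : Digraph V)

/-- `r` is (the vertex sequence of) a directed ray of `D`. -/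
def IsRay (r : ℕ → V) : Prop :=
  Function.Injective r ∧ ∀ n, D.Adj (r n) (r (n + 1))

/-- The ray `r` has a tail in the vertex set `C`. -/
def HasTailIn (r : ℕ → V) (C : Set V) : Prop :=
  ∃ N, ∀ n, N ≤ n → r n ∈ C

/-- A solid ray of `D`: a ray that, for every finite vertex set `X`, has a tail in some strong
component of `D - X`. -/
structure SolidRay where
  toFun : ℕ → V
  isRay : D.IsRay toFun
  solid : ∀ X : Finset V, ∃ C, D.IsStrongComp X C ∧ HasTailIn toFun C

/-- Equivalence of solid rays: for every finite vertex set `X`, both rays have a tail in the same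
strong component of `D - X`. -/
def SolidRay.Equivalent (r s : D.SolidRay) : Prop :=
  ∀ X : Finset V, ∃ C, D.IsStrongComp X C ∧ HasTailIn r.toFun C ∧ HasTailIn s.toFun C

theorem SolidRay.equivalence : Equivalence (SolidRay.Equivalent D) where
  refl r X := by
    obtain ⟨C, hC, h⟩ := r.solid X
    exact ⟨C, hC, h, h⟩
  symm h X := by
    obtain ⟨C, hC, h1, h2⟩ := h X
    exact ⟨C, hC, h2, h1⟩
  trans h h' X := by
    obtain ⟨C, hC, h1, N, hN⟩ := h X
    obtain ⟨C', hC', ⟨M, hM⟩, h2⟩ := h' X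
    have e : C = C' := IsStrongComp.eq_of_mem D hC hC'
      (hN _ (le_max_left N M)) (hM _ (le_max_right N M))
    exact ⟨C, hC, h1, e ▸ h2⟩

instance solidRaySetoid : Setoid D.SolidRay := ⟨SolidRay.Equivalent D, SolidRay.equivalence D⟩

/-- The ends of `D`: the equivalence classes of its solid rays. -/
def End : Type u := Quotient D.solidRaySetoid

/-- The end represented by a solid ray. -/
def SolidRay.toEnd {D : Digraph V} (r : D.SolidRay) : D.End := Quotient.mk D.solidRaySetoid r

/-- `C(X, ω)`, the (vertex set of the) strong component of `D - X` in which `ω` lives: a vertex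
belongs to it if some ray that represents `ω` has a tail in its strong component. -/
def endComp (X : Finset V) (ω : D.End) : Set V :=
  {v | ∃ r : D.SolidRay, r.toEnd = ω ∧ HasTailIn r.toFun (D.strongComp X v)}

theorem endComp_toEnd {X : Finset V} {C : Set V} (r : D.SolidRay) (hC : D.IsStrongComp X C)
    (h : HasTailIn r.toFun C) : D.endComp X r.toEnd = C := by
  obtain ⟨v, hv, rfl⟩ := hC
  ext w
  constructor
  · rintro ⟨s, hs, M, hM⟩
    obtain ⟨C', hC', ⟨N, hN⟩, K, hK⟩ := Quotient.exact hs X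
    obtain ⟨L, hL⟩ := h
    have hw : w ∉ X := (hM M le_rfl).1
    have e1 : D.strongComp X w = C' := IsStrongComp.eq_of_mem D ⟨w, hw, rfl⟩ hC'
      (hM _ (le_max_left M N)) (hN _ (le_max_right M N))
    have e2 : C' = D.strongComp X v := IsStrongComp.eq_of_mem D hC' ⟨v, hv, rfl⟩
      (hK _ (le_max_left K L)) (hL _ (le_max_right K L))
    rw [← e2, ← e1]
    exact ⟨hw, hw, .refl, .refl⟩
  · intro hw
    exact ⟨r, rfl, by rwa [D.strongComp_eq_of_mem hw]⟩

theorem isStrongComp_endComp (X : Finset V) (ω : D.End) : D.IsStrongComp X (D.endComp X ω) := by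
  induction ω using Quotient.inductionOn with
  | h r =>
    obtain ⟨C, hC, h⟩ := r.solid X
    have e : D.endComp X (Quotient.mk D.solidRaySetoid r) = C := D.endComp_toEnd r hC h
    rwa [e]

end Ends

section Space

variable {V : Type u} (D : Digraph V)

/-- The vertices and ends of `D`. -/
inductive Node : Type u
  | vert (v : V)
  | fin (ω : D.End)

/-- `IsEdge x y` says that `(x, y)` is an edge or a limit edge of `D`. Between two vertices these
are the edges of `D`, in the other three cases they are the limit edges. -/
def IsEdge : D.Node → D.Node → Prop
  | .vert v, .vert w => D.Adj v w
  | .fin ω, .fin η => ω ≠ η ∧ ∀ X : Finset V, D.endComp X ω ≠ D.endComp X η →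
      ∃ a ∈ D.endComp X ω, ∃ b ∈ D.endComp X η, D.Adj a b
  | .vert v, .fin ω => ∀ X : Finset V, v ∉ D.endComp X ω → ∃ b ∈ D.endComp X ω, D.Adj v b
  | .fin ω, .vert v => ∀ X : Finset V, v ∉ D.endComp X ω → ∃ a ∈ D.endComp X ω, D.Adj a v

/-- The set `E ∪ Λ` of all edges and limit edges of `D`. -/
structure Edge where
  tail : D.Node
  head : D.Node
  isEdge : D.IsEdge tail head

/-- The ground set of `|D|`. Gluing the end points of a copy of `[0,1]` for every edge or limit
edge `e` to the tail and the head of `e` leaves exactly the vertices, the ends, and the inner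
points `inner e t`, `0 < t < 1`, where `t` increases from the tail to the head of `e`. -/
inductive Space : Type u
  | node (x : D.Node)
  | inner (e : D.Edge) (t : Set.Ioo (0 : ℝ) 1)

variable {D}

/-- The vertices in the strong component `C` of `D - X` and the ends that live in `C`. -/
def nodesIn (X : Finset V) (C : Set V) : Set D.Node :=
  {x | match x with
    | .vert v => v ∈ C
    | .fin ω => D.endComp X ω = C}

/-- The uniform star of radius `ε` around a vertex (it has a partial edge on every edge and limit
edge at `v`). -/
def star (v : V) (ε : ℝ) : Set D.Space :=
  {p | match p with
    | .node x => x = .vert v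
    | .inner e t => (e.tail = .vert v ∧ (t : ℝ) < ε) ∨ (e.head = .vert v ∧ 1 - ε < (t : ℝ))}

/-- The open ball of radius `ε` around the inner point `z` of the edge `e`. -/
def edgeBall (e : D.Edge) (z ε : ℝ) : Set D.Space :=
  {p | ∃ t : Set.Ioo (0 : ℝ) 1, p = .inner e t ∧ |(t : ℝ) - z| < ε}

/-- The set `Ĉ_ε(X, ω)`: all vertices, ends, edges and limit edges in `C(X, ω)`, together with a
half-open partial edge of length `ε` for every edge or limit edge with an endpoint in `C(X, ω)`. -/
def endNhd (X : Finset V) (ω : D.End) (ε : ℝ) : Set D.Space :=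
  {p | match p with
    | .node x => x ∈ nodesIn X (D.endComp X ω)
    | .inner e t =>
        (e.tail ∈ nodesIn X (D.endComp X ω) ∧ e.head ∈ nodesIn X (D.endComp X ω)) ∨
        (e.tail ∈ nodesIn X (D.endComp X ω) ∧ (t : ℝ) < ε) ∨
        (e.head ∈ nodesIn X (D.endComp X ω) ∧ 1 - ε < (t : ℝ))}

/-- The union of the open balls of radius `ε` around the points corresponding to `z` on all edges
and limit edges with tail in `A` and head in `B`. -/
def bundleBalls (A B : Set D.Node) (z ε : ℝ) : Set D.Space :=
  {p | ∃ e : D.Edge, e.tail ∈ A ∧ e.head ∈ B ∧ p ∈ edgeBall e z ε}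

variable (D)

/-- The basic open sets of DTop. The bounds on `ε` keep all partial edges and balls within the
edges that they are taken from. -/
inductive IsBasicOpen : Set D.Space → Prop
  | vertex (v : V) (ε : ℝ) (hε : 0 < ε) (hε1 : ε ≤ 1) :
      IsBasicOpen (star v ε)
  | edge (e : D.Edge) (v w : V) (hv : e.tail = .vert v) (hw : e.head = .vert w)
      (z ε : ℝ) (hε : 0 < ε) (hz0 : ε ≤ z) (hz1 : ε ≤ 1 - z) :
      IsBasicOpen (edgeBall e z ε)
  | atEnd (X : Finset V) (ω : D.End) (ε : ℝ) (hε : 0 < ε) (hε1 : ε ≤ 1) :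
      IsBasicOpen (endNhd X ω ε)
  | endEnd (ω η : D.End) (hl : D.IsEdge (.fin ω) (.fin η)) (X : Finset V)
      (hX : D.endComp X ω ≠ D.endComp X η)
      (z ε : ℝ) (hε : 0 < ε) (hz0 : ε ≤ z) (hz1 : ε ≤ 1 - z) :
      IsBasicOpen
        (bundleBalls (nodesIn X (D.endComp X ω)) (nodesIn X (D.endComp X η)) z ε)
  | vertexEnd (v : V) (ω : D.End) (hl : D.IsEdge (.vert v) (.fin ω)) (X : Finset V) (hX : v ∈ X)
      (z ε : ℝ) (hε : 0 < ε) (hz0 : ε ≤ z) (hz1 : ε ≤ 1 - z) :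
      IsBasicOpen (bundleBalls {.vert v} (nodesIn X (D.endComp X ω)) z ε)
  | endVertex (ω : D.End) (v : V) (hl : D.IsEdge (.fin ω) (.vert v)) (X : Finset V) (hX : v ∈ X)
      (z ε : ℝ) (hε : 0 < ε) (hz0 : ε ≤ z) (hz1 : ε ≤ 1 - z) :
      IsBasicOpen (bundleBalls (nodesIn X (D.endComp X ω)) {.vert v} z ε)

/-- The topology DTop on `|D|`. -/
instance instTopologicalSpaceSpace : TopologicalSpace D.Space :=
  TopologicalSpace.generateFrom {U | D.IsBasicOpen U}

end Space

end Digraph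

/-!
If `D` is solid, compactness is shown with ultrafilters. An ultrafilter on `|D|` induces
ultrafilters on the set of vertices and ends, by sending an inner point of an edge to the tail or
to the head of this edge, and an ultrafilter of positions in `[0, 1]`. If the tails converge to
`x`, the heads to `y` and the positions to `s`, then the ultrafilter converges to `x` if `s = 0`,
to `y` if `s = 1`, to `x = y` if the limits agree, and to the point `s` of the pair `(x, y)`
otherwise, which is then an edge or limit edge (`NodeLimit.isEdge`). So it remains to see that
ultrafilters on the set of vertices and ends converge (`IsSolid.exists_nodeLimit`). As `D - X`
has finitely many strong components, a nonprincipal one selects a strong component of `D - X` for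
every finite `X`, consistently: a direction.

Every direction `f` is induced by an end (`IsDirection.exists_end`). Say that a vertex `v`
dominates `f` if it reaches `f X` in `D - X` for all finite `X` avoiding `v`, and is dominated by
`f` if the reverse holds. If both kinds of vertices occur in every `f X`, a closing-off argument
gives a countable vertex set in which a ray towards `f` can be found; the two kinds of vertices
keep its tails in `f Y` also for finite `Y` not contained in this set. If one kind is missing
from some `f X₀`, then iteratively adding finite sets witnessing this gives a sequence of sets
`X n` for which the sets `f (X n)` have empty intersection, and a ray with tails in all of them is
as desired. In both cases the ray comes from a decreasing sequence of strongly connected sets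
with empty intersection (`exists_ray_of_antitone`).

Conversely, for any finite `X`, every point of `|D|` has a neighbourhood that meets at most one
strong component of `D - X`. Hence if `|D|` is compact, then `D - X` has only finitely many of
them.
-/

namespace Digraph

open Relation Filter Topology

/-! ### Strongly connected sets and strong components -/

section StronglyConnected

universe u

variable {V : Type u} (D : Digraph V)

/-- `b` can be reached from `a` by a directed path of `D` all of whose edges have both ends
in `C`. -/
def ReachWithin (C : Set V) (a b : V) : Prop :=
  ReflTransGen (fun x y => x ∈ C ∧ y ∈ C ∧ D.Adj x y) a b

/-- The subdigraph of `D` induced by the vertex set `C` is strongly connected (or empty). -/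
def StronglyConnectedOn (C : Set V) : Prop :=
  ∀ a ∈ C, ∀ b ∈ C, D.ReachWithin C a b

variable {D}

theorem ReachWithin.mono {C C' : Set V} {a b : V} (h : D.ReachWithin C a b) (hC : C ⊆ C') :
    D.ReachWithin C' a b :=
  ReflTransGen.mono (fun _ _ ⟨h1, h2, h3⟩ => ⟨hC h1, hC h2, h3⟩) _ _ h

theorem ReachWithin.reachAvoiding {C : Set V} {X : Finset V} {a b : V}
    (h : D.ReachWithin C a b) (hX : ∀ x ∈ C, x ∉ X) : D.ReachAvoiding X a b :=
  ReflTransGen.mono (fun _ _ ⟨h1, h2, h3⟩ => ⟨hX _ h1, hX _ h2, h3⟩) _ _ h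

theorem ReachAvoiding.anti {X Y : Finset V} {a b : V} (h : D.ReachAvoiding Y a b) (hXY : X ⊆ Y) :
    D.ReachAvoiding X a b :=
  ReflTransGen.mono (fun _ _ ⟨h1, h2, h3⟩ => ⟨fun h => h1 (hXY h), fun h => h2 (hXY h), h3⟩)
    _ _ h

/-- A walk inside `C` uses only finitely many vertices. -/
theorem ReachWithin.exists_finset {C : Set V} {a b : V} (h : D.ReachWithin C a b) :
    ∃ G : Finset V, (G : Set V) ⊆ C ∧ D.ReachWithin G a b := by
  classical
  induction h with
  | refl => exact ⟨∅, by simp, .refl⟩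
  | @tail b c _ hbc ih =>
    obtain ⟨G, hG, hab⟩ := ih
    refine ⟨insert b (insert c G), ?_, ?_⟩
    · intro x hx
      simp only [Finset.coe_insert, Set.mem_insert_iff, Finset.mem_coe] at hx
      rcases hx with rfl | rfl | hx
      exacts [hbc.1, hbc.2.1, hG hx]
    · exact (hab.mono (by intro x hx; simp_all)).tail ⟨by simp, by simp, hbc.2.2⟩

theorem mem_strongComp_self {X : Finset V} {v : V} (hv : v ∉ X) : v ∈ D.strongComp X v :=
  ⟨hv, hv, .refl, .refl⟩

theorem IsStrongComp.nonempty {X : Finset V} {C : Set V} (hC : D.IsStrongComp X C) :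
    C.Nonempty := by
  obtain ⟨v, hv, rfl⟩ := hC
  exact ⟨v, mem_strongComp_self hv⟩

theorem IsStrongComp.notMem {X : Finset V} {C : Set V} (hC : D.IsStrongComp X C) {v : V}
    (h : v ∈ C) : v ∉ X := by
  obtain ⟨w, hw, rfl⟩ := hC
  exact h.2.1

theorem IsStrongComp.reachAvoiding {X : Finset V} {C : Set V} (hC : D.IsStrongComp X C) {v w : V}
    (hv : v ∈ C) (hw : w ∈ C) : D.ReachAvoiding X v w := by
  obtain ⟨u, -, rfl⟩ := hC
  exact hv.2.2.2.trans hw.2.2.1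

theorem IsStrongComp.mem_of_reachAvoiding {X : Finset V} {C : Set V} (hC : D.IsStrongComp X C)
    {v w x : V} (hv : v ∈ C) (hw : w ∈ C) (hx : x ∉ X) (hvx : D.ReachAvoiding X v x)
    (hxw : D.ReachAvoiding X x w) : x ∈ C := by
  have hwv := hC.reachAvoiding hw hv
  obtain ⟨u, -, rfl⟩ := hC
  exact ⟨hv.1, hx, hv.2.2.1.trans hvx, hxw.trans (hwv.trans hv.2.2.2)⟩

/-- Paths of `D - X` between vertices of a strong component do not leave this component. -/
theorem IsStrongComp.stronglyConnectedOn {X : Finset V} {C : Set V} (hC : D.IsStrongComp X C) :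
    D.StronglyConnectedOn C := by
  intro a ha b hb
  suffices ∀ x, D.ReachAvoiding X x b → x ∈ C → D.ReachWithin C x b from
    this a (hC.reachAvoiding ha hb) ha
  intro x hx
  induction hx using ReflTransGen.head_induction_on with
  | refl => exact fun _ => .refl
  | @head y c hyc hcb ih =>
    intro hy
    have hc : c ∈ C := hC.mem_of_reachAvoiding hy hb hyc.2.1 (.single hyc) hcb
    exact .head ⟨hy, hc, hyc.2.2⟩ (ih hc)

theorem IsStrongComp.subset_of_stronglyConnectedOn {X : Finset V} {C S : Set V}
    (hC : D.IsStrongComp X C) (hS : D.StronglyConnectedOn S) (hSX : ∀ x ∈ S, x ∉ X) {z : V}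
    (hzS : z ∈ S) (hzC : z ∈ C) : S ⊆ C := fun x hx =>
  hC.mem_of_reachAvoiding hzC hzC (hSX x hx) ((hS z hzS x hx).reachAvoiding hSX)
    ((hS x hx z hzS).reachAvoiding hSX)

/-- If every vertex of `C` can reach `B ⊆ C` within `C`, then some potential on `C` can be
decreased along an edge at every vertex outside `B`, namely the distance from `B`. -/
theorem exists_potential {C B : Set V} (hC : ∀ v ∈ C, ∃ b ∈ B, D.ReachWithin C v b) :
    ∃ d : V → ℕ, ∀ v ∈ C, v ∉ B → ∃ w ∈ C, D.Adj v w ∧ d w < d v := by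
  classical
  let level : ℕ → Set V := fun k =>
    Nat.rec B (fun _ L => {v | v ∈ C ∧ ∃ w ∈ L, w ∈ C ∧ D.Adj v w}) k
  have hlevel : ∀ v ∈ C, ∃ k, v ∈ level k := by
    intro v hv
    obtain ⟨b, hb, h⟩ := hC v hv
    clear hv
    induction h using ReflTransGen.head_induction_on with
    | refl => exact ⟨0, hb⟩
    | @head x y hxy _ ih =>
      obtain ⟨k, hk⟩ := ih
      exact ⟨k + 1, hxy.1, y, hk, hxy.2.1, hxy.2.2⟩
  refine ⟨fun v => sInf {k | v ∈ level k}, fun v hv hvB => ?_⟩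
  have hmem : v ∈ level (sInf {k | v ∈ level k}) := Nat.sInf_mem (hlevel v hv)
  cases hk : sInf {k | v ∈ level k} with
  | zero => rw [hk] at hmem; exact absurd hmem hvB
  | succ k =>
    rw [hk] at hmem
    obtain ⟨-, w, hw, hwC, hvw⟩ := hmem
    refine ⟨w, hwC, hvw, ?_⟩
    change sInf {k | w ∈ level k} < sInf {k | v ∈ level k}
    rw [hk]
    exact Nat.lt_succ_of_le (Nat.sInf_le hw)

/-- A decreasing sequence of nonempty strongly connected vertex sets with empty intersection
contains a ray that has a tail in each of them. -/
theorem exists_ray_of_antitone {C : ℕ → Set V} (hanti : Antitone C) (hne : ∀ n, (C n).Nonempty)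
    (hconn : ∀ n, D.StronglyConnectedOn (C n)) (hempty : ∀ v, ∃ n, v ∉ C n) :
    ∃ r : ℕ → V, D.IsRay r ∧ ∀ n, HasTailIn r (C n) := by
  classical
  have hd : ∀ n, ∃ d : V → ℕ, ∀ v ∈ C n, v ∉ C (n + 1) → ∃ w ∈ C n, D.Adj v w ∧ d w < d v :=
    fun n => exists_potential fun v hv =>
      let ⟨b, hb⟩ := hne (n + 1)
      ⟨b, hb, hconn n v hv b (hanti n.le_succ hb)⟩
  choose d hd using hd
  -- `ρ v` is the last index `n` with `v ∈ C n`, for `v ∈ C 0`.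
  have hex : ∀ v, ∃ n, v ∉ C (n + 1) := fun v =>
    (hempty v).imp fun n hn h => hn (hanti n.le_succ h)
  let ρ : V → ℕ := fun v => Nat.find (hex v)
  have hρ_notMem : ∀ v, v ∉ C (ρ v + 1) := fun v => Nat.find_spec (hex v)
  have hρ_mem : ∀ v ∈ C 0, v ∈ C (ρ v) := by
    intro v hv
    cases h : ρ v with
    | zero => exact hv
    | succ k => exact not_not.1 (Nat.find_min (hex v) (show k < ρ v by omega))
  have hle : ∀ v n, v ∈ C n → n ≤ ρ v := by
    intro v n hv
    by_contra h
    exact hρ_notMem v (hanti (by omega) hv)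
  -- Each step of the ray increases `ρ`, or keeps `ρ` and comes closer to the next set.
  have hstep : ∀ v : C 0, ∃ w : C 0, D.Adj v w ∧
      (ρ v < ρ w ∨ ρ w = ρ v ∧ d (ρ v) w < d (ρ v) v) := by
    rintro ⟨v, hv⟩
    obtain ⟨w, hw, hvw, hlt⟩ := hd (ρ v) v (hρ_mem v hv) (hρ_notMem v)
    refine ⟨⟨w, hanti (Nat.zero_le _) hw⟩, hvw, ?_⟩
    rcases (hle w _ hw).lt_or_eq with h | h
    exacts [.inl h, .inr ⟨h.symm, hlt⟩]
  choose next hadj hnext using hstep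
  obtain ⟨v₀, hv₀⟩ := hne 0
  let r : ℕ → C 0 := fun n => next^[n] ⟨v₀, hv₀⟩
  have hr : ∀ n, r (n + 1) = next (r n) := fun n => Function.iterate_succ_apply' _ _ _
  have hmono : Monotone fun n => ρ (r n) := by
    refine monotone_nat_of_le_succ fun n => ?_
    rw [hr]
    rcases hnext (r n) with h | h
    exacts [h.le, h.1.ge]
  have hinj : Function.Injective fun n => (r n : V) := by
    have : StrictMono fun n => toLex (ρ (r n), OrderDual.toDual (d (ρ (r n)) (r n))) := by
      refine strictMono_nat_of_lt_succ fun n => ?_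
      rw [Prod.Lex.toLex_lt_toLex, hr]
      rcases hnext (r n) with h | ⟨h1, h2⟩
      · exact .inl h
      · refine .inr ⟨h1.symm, ?_⟩
        simpa only [h1, OrderDual.toDual_lt_toDual] using h2
    intro m n hmn
    apply this.injective
    simp only at hmn
    simp only [hmn]
  have hgrow : ∀ k n, d (ρ (r n)) (r n) = k → ∃ m, ρ (r n) < ρ (r m) := by
    intro k
    induction k using Nat.strong_induction_on with
    | _ k ih =>
      intro n hn
      rcases hnext (r n) with h | ⟨h1, h2⟩
      · exact ⟨n + 1, by rw [hr]; exact h⟩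
      · have h := ih (d (ρ (r (n + 1))) (r (n + 1))) (by rw [hr, h1]; omega) (n + 1) rfl
        rwa [hr, h1] at h
  have hunbounded : ∀ k, ∃ n, k ≤ ρ (r n) := by
    intro k
    induction k with
    | zero => exact ⟨0, Nat.zero_le _⟩
    | succ k ih =>
      obtain ⟨n, hn⟩ := ih
      obtain ⟨m, hm⟩ := hgrow _ n rfl
      exact ⟨m, by omega⟩
  refine ⟨fun n => r n, ⟨hinj, fun n => ?_⟩, fun k => ?_⟩
  · change D.Adj (r n) (r (n + 1))
    rw [hr]
    exact hadj _
  · obtain ⟨N, hN⟩ := hunbounded k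
    exact ⟨N, fun n hn => hanti (hN.trans (hmono hn)) (hρ_mem _ (r n).2)⟩

end StronglyConnected

/-! ### Directions and ends -/

section Directions

universe u

variable {V : Type u} {D : Digraph V}

/-- A direction of `D`: a choice of a strong component of `D - X` for every finite vertex set `X`,
such that these components shrink as `X` grows. -/
structure IsDirection (D : Digraph V) (f : Finset V → Set V) : Prop where
  isStrongComp : ∀ X, D.IsStrongComp X (f X)
  antitone : Antitone f

theorem endComp_antitone (ω : D.End) : Antitone fun X => D.endComp X ω := by
  intro X Y hXY
  induction ω using Quotient.inductionOn with
  | h r =>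
    obtain ⟨C, hC, M, hM⟩ := r.solid X
    obtain ⟨C', hC', N, hN⟩ := r.solid Y
    have e : D.endComp X (Quotient.mk D.solidRaySetoid r) = C := D.endComp_toEnd r hC ⟨M, hM⟩
    have e' : D.endComp Y (Quotient.mk D.solidRaySetoid r) = C' := D.endComp_toEnd r hC' ⟨N, hN⟩
    change D.endComp Y _ ⊆ D.endComp X _
    rw [e, e']
    exact hC.subset_of_stronglyConnectedOn hC'.stronglyConnectedOn
      (fun x hx h => hC'.notMem hx (hXY h)) (hN _ (le_max_right M N)) (hM _ (le_max_left M N))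

/-- Distinct ends are separated by some finite vertex set. -/
theorem exists_endComp_ne {ω η : D.End} (h : ω ≠ η) :
    ∃ X, D.endComp X ω ≠ D.endComp X η := by
  by_contra! hX
  apply h
  induction ω using Quotient.inductionOn with
  | h r =>
    induction η using Quotient.inductionOn with
    | h s =>
      refine Quotient.sound fun X => ?_
      obtain ⟨C, hC, hr⟩ := r.solid X
      obtain ⟨C', hC', hs⟩ := s.solid X
      have e : D.endComp X (Quotient.mk D.solidRaySetoid r) = C := D.endComp_toEnd r hC hr
      have e' : D.endComp X (Quotient.mk D.solidRaySetoid s) = C' := D.endComp_toEnd s hC' hs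
      have : C = C' := by rw [← e, ← e', hX X]
      exact ⟨C, hC, hr, this ▸ hs⟩

theorem exists_end_of_ray {f : Finset V → Set V} (hf : D.IsDirection f) {r : ℕ → V}
    (hr : D.IsRay r) (htail : ∀ X, HasTailIn r (f X)) : ∃ ω : D.End, ∀ X, D.endComp X ω = f X :=
  ⟨SolidRay.toEnd ⟨r, hr, fun X => ⟨f X, hf.isStrongComp X, htail X⟩⟩, fun X =>
    D.endComp_toEnd _ (hf.isStrongComp X) (htail X)⟩

/-- Suppose that every vertex of `f X₀` can be prevented from reaching the sets `f X` by a finite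
set of other vertices. Iterating the addition of such finite sets gives a sequence along which
the sets `f X` have empty intersection: on a path inside `f X₀` from an element of the first set to
a vertex common to all `f (X n)`, a vertex in `X n` would always be followed by one in `X (n + 1)`,
although the last vertex of the path is in no `X n`.

This is applied to `D` and to the digraph obtained by reversing its edges. -/
theorem exists_monotone_exhausting {G : Digraph V} {f : Finset V → Set V} (hanti : Antitone f)
    (hne : ∀ X, (f X).Nonempty) (hdisj : ∀ X, ∀ v ∈ f X, v ∉ X) {X₀ : Finset V}
    (hconn : G.StronglyConnectedOn (f X₀))
    (hsep : ∀ v ∈ f X₀, ∃ X : Finset V, v ∉ X ∧ ∀ z ∈ f X, ¬ G.ReachAvoiding X v z) :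
    ∃ X : ℕ → Finset V, Monotone X ∧ ∀ v, ∃ n, v ∉ f (X n) := by
  classical
  have hsep' : ∀ v, ∃ X : Finset V, v ∈ f X₀ → v ∉ X ∧ ∀ z ∈ f X, ¬ G.ReachAvoiding X v z := by
    intro v
    by_cases hv : v ∈ f X₀
    · exact (hsep v hv).imp fun X hX _ => hX
    · exact ⟨∅, fun h => absurd h hv⟩
  choose g hg using hsep'
  obtain ⟨w, hw⟩ := hne X₀
  let X : ℕ → Finset V := fun n => (fun T => T ∪ T.biUnion g)^[n] (insert w X₀)
  have hX : ∀ n, X (n + 1) = X n ∪ (X n).biUnion g := fun n => Function.iterate_succ_apply' _ _ _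
  have hmono : Monotone X :=
    monotone_nat_of_le_succ fun n => by rw [hX]; exact Finset.subset_union_left
  refine ⟨X, hmono, ?_⟩
  by_contra! hv
  obtain ⟨v, hv⟩ := hv
  have hvX₀ : v ∈ f X₀ := hanti (Finset.subset_insert w X₀) (hv 0)
  suffices ∀ x, G.ReachWithin (f X₀) x v → ∀ n, x ∉ X n ∧ G.ReachAvoiding (X n) x v from
    (this w (hconn w hw v hvX₀) 0).1 (Finset.mem_insert_self w X₀)
  intro x hx
  induction hx using ReflTransGen.head_induction_on with
  | refl => exact fun n => ⟨hdisj _ _ (hv n), .refl⟩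
  | @head x c hxc _ ih =>
    have hxX : ∀ n, x ∉ X n := by
      intro n hxn
      have hsub : g x ⊆ X (n + 1) := by
        rw [hX]
        exact (Finset.subset_biUnion_of_mem g hxn).trans Finset.subset_union_right
      have hcX := ih (n + 1)
      exact (hg x hxc.1).2 v (hanti hsub (hv (n + 1)))
        (.head ⟨(hg x hxc.1).1, fun h => hcX.1 (hsub h), hxc.2.2⟩ (hcX.2.anti hsub))
    exact fun n => ⟨hxX n, .head ⟨hxX n, (ih n).1, hxc.2.2⟩ (ih n).2⟩

/-- A direction that is exhausted by a sequence of finite vertex sets is induced by an end. -/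
theorem IsDirection.exists_end_of_exhausting {f : Finset V → Set V} (hf : D.IsDirection f)
    {X : ℕ → Finset V} (hX : Monotone X) (hempty : ∀ v, ∃ n, v ∉ f (X n)) :
    ∃ ω : D.End, ∀ X, D.endComp X ω = f X := by
  classical
  have hanti : Antitone fun n => f (X n) := fun m n h => hf.antitone (hX h)
  obtain ⟨r, hr, htail⟩ := exists_ray_of_antitone hanti (fun n => (hf.isStrongComp _).nonempty)
    (fun n => (hf.isStrongComp _).stronglyConnectedOn) hempty
  refine exists_end_of_ray hf hr fun Y => ?_
  choose N hN using hempty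
  obtain ⟨M, hM⟩ := htail (Y.sup N)
  have hdisj : ∀ x ∈ f (X (Y.sup N)), x ∉ Y := fun x hx hxY =>
    hN x (hanti (Finset.le_sup hxY) hx)
  obtain ⟨z, hz⟩ := (hf.isStrongComp (X (Y.sup N) ∪ Y)).nonempty
  have hsub : f (X (Y.sup N)) ⊆ f Y :=
    (hf.isStrongComp Y).subset_of_stronglyConnectedOn (hf.isStrongComp _).stronglyConnectedOn hdisj
      (hf.antitone Finset.subset_union_left hz) (hf.antitone Finset.subset_union_right hz)
  exact ⟨M, fun n hn => hsub (hM n hn)⟩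

/-- Suppose that every `f X` contains a vertex `p X` that no finite set of other vertices can
prevent from reaching the sets `f Y`, and a vertex `q X` that no finite set of other vertices can
prevent from being reached from the sets `f Y`. Then the direction `f` is induced by an end.

The ray is found in a countable vertex set `S` which, for every finite `X ⊆ S`, contains `p X` and
`q X` and meets `f X` in a strongly connected set. A finite set `Y` of vertices meets `S` in a
finite subset of `S`, and so it does not separate a tail of the ray from `f Y`. -/
theorem IsDirection.exists_end_of_dominating {f : Finset V → Set V} (hf : D.IsDirection f)
    {p q : Finset V → V} (hp : ∀ X, p X ∈ f X) (hq : ∀ X, q X ∈ f X)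
    (hpf : ∀ X Y, p X ∉ Y → ∃ z ∈ f Y, D.ReachAvoiding Y (p X) z)
    (hqf : ∀ X Y, q X ∉ Y → ∃ z ∈ f Y, D.ReachAvoiding Y z (q X)) :
    ∃ ω : D.End, ∀ X, D.endComp X ω = f X := by
  classical
  have hpath : ∀ X a b, ∃ G : Finset V, a ∈ f X → b ∈ f X →
      (G : Set V) ⊆ f X ∧ D.ReachWithin G a b := by
    intro X a b
    by_cases h : a ∈ f X ∧ b ∈ f X
    · obtain ⟨G, hG⟩ := ((hf.isStrongComp X).stronglyConnectedOn a h.1 b h.2).exists_finset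
      exact ⟨G, fun _ _ => hG⟩
    · exact ⟨∅, fun ha hb => absurd ⟨ha, hb⟩ h⟩
  choose g hg using hpath
  let close : Finset V → Finset V := fun T =>
    T ∪ T.powerset.biUnion fun X => {p X, q X} ∪ (T ×ˢ T).biUnion fun ab => g X ab.1 ab.2
  let T : ℕ → Finset V := fun n => close^[n] ∅
  have hT : ∀ n, T (n + 1) = close (T n) := fun n => Function.iterate_succ_apply' _ _ _
  have hTmono : Monotone T :=
    monotone_nat_of_le_succ fun n => by rw [hT]; exact Finset.subset_union_left
  have hTsub : ∀ m n, m ≤ n →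
      {p (T m), q (T m)} ∪ (T n ×ˢ T n).biUnion (fun ab => g (T m) ab.1 ab.2) ⊆ T (n + 1) := by
    intro m n hmn
    rw [hT]
    refine Finset.Subset.trans ?_ Finset.subset_union_right
    exact Finset.subset_biUnion_of_mem
      (fun X => {p X, q X} ∪ (T n ×ˢ T n).biUnion fun ab => g X ab.1 ab.2)
      (Finset.mem_powerset.2 (hTmono hmn))
  let S : Set V := {v | ∃ n, v ∈ T n}
  have hpS : ∀ n, p (T n) ∈ S := fun n => ⟨n + 1, hTsub n n le_rfl (by simp)⟩
  have hqS : ∀ n, q (T n) ∈ S := fun n => ⟨n + 1, hTsub n n le_rfl (by simp)⟩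
  have hconn : ∀ n, D.StronglyConnectedOn (S ∩ f (T n)) := by
    rintro n a ⟨⟨i, ha⟩, haf⟩ b ⟨⟨j, hb⟩, hbf⟩
    obtain ⟨hGf, hG⟩ := hg (T n) a b haf hbf
    refine hG.mono fun x hx => ⟨⟨max n (max i j) + 1, ?_⟩, hGf hx⟩
    refine hTsub n _ (le_max_left _ _) (Finset.mem_union_right _ ?_)
    refine Finset.mem_biUnion.2 ⟨(a, b), Finset.mem_product.2 ⟨?_, ?_⟩, hx⟩
    · exact hTmono ((le_max_left i j).trans (le_max_right _ _)) ha
    · exact hTmono ((le_max_right i j).trans (le_max_right _ _)) hb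
  have hanti : Antitone fun n => S ∩ f (T n) := fun m n h =>
    Set.inter_subset_inter_right _ (hf.antitone (hTmono h))
  have hempty : ∀ v, ∃ n, v ∉ S ∩ f (T n) := by
    intro v
    by_cases hv : v ∈ S
    · exact hv.imp fun n hn h => (hf.isStrongComp _).notMem h.2 hn
    · exact ⟨0, fun h => hv h.1⟩
  obtain ⟨r, hr, htail⟩ := exists_ray_of_antitone hanti (fun n => ⟨_, hpS n, hp _⟩) hconn hempty
  refine exists_end_of_ray hf hr fun Y => ?_
  choose N hN using hempty
  have hdisj : ∀ x ∈ S ∩ f (T (Y.sup N)), x ∉ Y := fun x hx hxY =>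
    hN x (hanti (Finset.le_sup hxY) hx)
  have hpn : p (T (Y.sup N)) ∈ S ∩ f (T (Y.sup N)) := ⟨hpS _, hp _⟩
  have hqn : q (T (Y.sup N)) ∈ S ∩ f (T (Y.sup N)) := ⟨hqS _, hq _⟩
  obtain ⟨z, hz, hpz⟩ := hpf _ Y (hdisj _ hpn)
  obtain ⟨z', hz', hqz⟩ := hqf _ Y (hdisj _ hqn)
  obtain ⟨M, hM⟩ := htail (Y.sup N)
  refine ⟨M, fun n hn => (hf.isStrongComp Y).mem_of_reachAvoiding hz' hz (hdisj _ (hM n hn)) ?_ ?_⟩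
  · exact hqz.trans ((hconn _ _ hqn _ (hM n hn)).reachAvoiding hdisj)
  · exact ((hconn _ _ (hM n hn) _ hpn).reachAvoiding hdisj).trans hpz

/-- Every direction is induced by an end. -/
theorem IsDirection.exists_end {f : Finset V → Set V} (hf : D.IsDirection f) :
    ∃ ω : D.End, ∀ X, D.endComp X ω = f X := by
  have hne : ∀ X, (f X).Nonempty := fun X => (hf.isStrongComp X).nonempty
  have hdisj : ∀ X, ∀ v ∈ f X, v ∉ X := fun X v hv => (hf.isStrongComp X).notMem hv
  by_cases hp : ∀ X, ∃ v ∈ f X, ∀ Y, v ∉ Y → ∃ z ∈ f Y, D.ReachAvoiding Y v z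
  · by_cases hq : ∀ X, ∃ v ∈ f X, ∀ Y, v ∉ Y → ∃ z ∈ f Y, D.ReachAvoiding Y z v
    · choose p hp hpf using hp
      choose q hq hqf using hq
      exact hf.exists_end_of_dominating hp hq hpf hqf
    · push Not at hq
      obtain ⟨X₀, hX₀⟩ := hq
      let G : Digraph V := ⟨fun a b => D.Adj b a⟩
      have hconn : G.StronglyConnectedOn (f X₀) := fun a ha b hb =>
        ReflTransGen.mono (fun _ _ h => ⟨h.2.1, h.1, h.2.2⟩) _ _
          (ReflTransGen.swap _ _ ((hf.isStrongComp X₀).stronglyConnectedOn b hb a ha))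
      obtain ⟨X, hX, hempty⟩ := exists_monotone_exhausting hf.antitone hne hdisj hconn
        fun v hv => (hX₀ v hv).imp fun Y hY => ⟨hY.1, fun z hz h => hY.2 z hz <|
          ReflTransGen.mono (fun _ _ h => ⟨h.2.1, h.1, h.2.2⟩) _ _ (ReflTransGen.swap _ _ h)⟩
      exact hf.exists_end_of_exhausting hX hempty
  · push Not at hp
    obtain ⟨X₀, hX₀⟩ := hp
    obtain ⟨X, hX, hempty⟩ := exists_monotone_exhausting hf.antitone hne hdisj
      (hf.isStrongComp X₀).stronglyConnectedOn hX₀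
    exact hf.exists_end_of_exhausting hX hempty

end Directions

/-! ### Convergence of ultrafilters on the vertices and ends -/

section Nodes

universe u

variable {V : Type u} {D : Digraph V}

/-- The ultrafilter `𝒱` on the vertices and ends converges to `x`: it is principal at `x` if `x`
is a vertex, and it contains `nodesIn X C` for every strong component `C` of `D - X` that `x`
is in. -/
structure NodeLimit (𝒱 : Ultrafilter D.Node) (x : D.Node) : Prop where
  vert : ∀ v, x = .vert v → {.vert v} ∈ 𝒱
  comp : ∀ X C, D.IsStrongComp X C → x ∈ nodesIn X C → nodesIn X C ∈ 𝒱

theorem NodeLimit.endComp {𝒱 : Ultrafilter D.Node} {ω : D.End} (h : NodeLimit 𝒱 (.fin ω))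
    (X : Finset V) : nodesIn X (D.endComp X ω) ∈ 𝒱 :=
  h.comp X _ (D.isStrongComp_endComp X ω) rfl

/-- In a solid digraph, every ultrafilter on the vertices and ends converges. Unless it is
principal at a vertex, the strong components that it selects form a direction, and it converges
to the end inducing this direction. -/
theorem IsSolid.exists_nodeLimit (hD : D.IsSolid) (𝒱 : Ultrafilter D.Node) :
    ∃ x, NodeLimit 𝒱 x := by
  by_cases hv : ∃ v : V, ({.vert v} : Set D.Node) ∈ 𝒱
  · obtain ⟨v, hv⟩ := hv
    refine ⟨.vert v, fun w hw => hw ▸ hv, fun X C _ hC => mem_of_superset hv ?_⟩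
    rintro _ rfl
    exact hC
  push Not at hv
  have hsel : ∀ X : Finset V, ∃ C, D.IsStrongComp X C ∧ nodesIn X C ∈ 𝒱 := by
    intro X
    have hX : (⋃ v ∈ (X : Set V), ({.vert v} : Set D.Node)) ∉ 𝒱 := by
      rw [Ultrafilter.finite_biUnion_mem_iff X.finite_toSet]
      rintro ⟨v, -, h⟩
      exact hv v h
    refine (Ultrafilter.finite_biUnion_mem_iff (hD X)).1
      (mem_of_superset (Ultrafilter.compl_mem_iff_notMem.2 hX) ?_)
    rintro (v | ω) hx
    · have hvX : v ∉ X := fun h => hx (Set.mem_biUnion h rfl)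
      exact Set.mem_biUnion (show D.IsStrongComp X _ from ⟨v, hvX, rfl⟩) (mem_strongComp_self hvX)
    · exact Set.mem_biUnion (D.isStrongComp_endComp X ω) rfl
  choose f hf hf𝒱 using hsel
  have hdir : D.IsDirection f := by
    refine ⟨hf, fun X Y hXY => ?_⟩
    obtain ⟨x, hxY, hxX⟩ := 𝒱.nonempty_of_mem (inter_mem (hf𝒱 Y) (hf𝒱 X))
    rcases x with v | ω
    · exact (hf X).subset_of_stronglyConnectedOn (hf Y).stronglyConnectedOn
        (fun x hx h => (hf Y).notMem hx (hXY h)) hxY hxX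
    · have hY : D.endComp Y ω = f Y := hxY
      have hX : D.endComp X ω = f X := hxX
      rw [← hX, ← hY]
      exact endComp_antitone ω hXY
  obtain ⟨ω, hω⟩ := hdir.exists_end
  refine ⟨.fin ω, ⟨(by rintro _ ⟨⟩), fun X C _ hC => ?_⟩⟩
  have : f X = C := (hω X).symm.trans hC
  exact this ▸ hf𝒱 X

/-- An edge or limit edge from a vertex outside `C(X, ω)` to `C(X, ω)` yields such an edge
of `D`. -/
theorem exists_adj_of_edge_vert_fin {e : D.Edge} {X : Finset V} {ω : D.End} {v : V}
    (hv : v ∉ D.endComp X ω) (ht : e.tail = .vert v) (hh : e.head ∈ nodesIn X (D.endComp X ω)) :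
    ∃ b ∈ D.endComp X ω, D.Adj v b := by
  obtain ⟨x, y, he⟩ := e
  obtain rfl : x = .vert v := ht
  rcases y with b | η
  · exact ⟨b, hh, he⟩
  · have hη : D.endComp X η = D.endComp X ω := hh
    exact hη ▸ he X (hη ▸ hv)

theorem exists_adj_of_edge_fin_vert {e : D.Edge} {X : Finset V} {ω : D.End} {v : V}
    (hv : v ∉ D.endComp X ω) (ht : e.tail ∈ nodesIn X (D.endComp X ω)) (hh : e.head = .vert v) :
    ∃ a ∈ D.endComp X ω, D.Adj a v := by
  obtain ⟨x, y, he⟩ := e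
  obtain rfl : y = .vert v := hh
  rcases x with a | η
  · exact ⟨a, ht, he⟩
  · have hη : D.endComp X η = D.endComp X ω := ht
    exact hη ▸ he X (hη ▸ hv)

/-- An edge or limit edge from `C(X, ω)` to `C(X, η) ≠ C(X, ω)` yields such an edge of `D`. -/
theorem exists_adj_of_edge_fin_fin {e : D.Edge} {X : Finset V} {ω η : D.End}
    (hX : D.endComp X ω ≠ D.endComp X η) (ht : e.tail ∈ nodesIn X (D.endComp X ω))
    (hh : e.head ∈ nodesIn X (D.endComp X η)) :
    ∃ a ∈ D.endComp X ω, ∃ b ∈ D.endComp X η, D.Adj a b := by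
  have hdisj : ∀ v, v ∈ D.endComp X ω → v ∉ D.endComp X η := fun v h h' =>
    hX ((D.isStrongComp_endComp X ω).eq_of_mem D (D.isStrongComp_endComp X η) h h')
  obtain ⟨x, y, he⟩ := e
  rcases x with a | ω'
  · exact ⟨a, ht, exists_adj_of_edge_vert_fin (e := ⟨.vert a, y, he⟩) (hdisj a ht) rfl hh⟩
  · rcases y with b | η'
    · obtain ⟨a, ha, hab⟩ := exists_adj_of_edge_fin_vert (e := ⟨.fin ω', .vert b, he⟩)
        (fun h => hdisj b h hh) ht rfl
      exact ⟨a, ha, b, hh, hab⟩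
    · have hω : D.endComp X ω' = D.endComp X ω := ht
      have hη : D.endComp X η' = D.endComp X η := hh
      rw [← hω, ← hη] at hX ⊢
      exact he.2 X hX

/-- The limits of the tails and of the heads of a convergent family of edges and limit edges, if
distinct, form an edge or limit edge. -/
theorem NodeLimit.isEdge {𝒱 𝒲 : Ultrafilter D.Node} {x y : D.Node} (hx : NodeLimit 𝒱 x)
    (hy : NodeLimit 𝒲 y) (hxy : x ≠ y)
    (hedge : ∀ A ∈ 𝒱, ∀ B ∈ 𝒲, ∃ e : D.Edge, e.tail ∈ A ∧ e.head ∈ B) : D.IsEdge x y := by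
  rcases x with v | ω <;> rcases y with w | η
  · obtain ⟨⟨x, y, he⟩, ht, hh⟩ := hedge _ (hx.vert v rfl) _ (hy.vert w rfl)
    obtain rfl : x = .vert v := ht
    obtain rfl : y = .vert w := hh
    exact he
  · intro X hX
    obtain ⟨e, ht, hh⟩ := hedge _ (hx.vert v rfl) _ (hy.endComp X)
    exact exists_adj_of_edge_vert_fin hX ht hh
  · intro X hX
    obtain ⟨e, ht, hh⟩ := hedge _ (hx.endComp X) _ (hy.vert w rfl)
    exact exists_adj_of_edge_fin_vert hX ht hh
  · refine ⟨fun h => hxy (by rw [h]), fun X hX => ?_⟩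
    obtain ⟨e, ht, hh⟩ := hedge _ (hx.endComp X) _ (hy.endComp X)
    exact exists_adj_of_edge_fin_fin hX ht hh

end Nodes

/-! ### Compactness of the space of a solid digraph -/

section Compact

universe u

variable {V : Type u} {D : Digraph V}

/-- The tail of the edge or limit edge containing an inner point; a vertex or end is mapped
to itself. -/
def Space.tail : D.Space → D.Node
  | .node x => x
  | .inner e _ => e.tail

/-- The head of the edge or limit edge containing an inner point; a vertex or end is mapped
to itself. -/
def Space.head : D.Space → D.Node
  | .node x => x
  | .inner e _ => e.head

/-- The position of an inner point on its edge or limit edge; the value at a vertex or end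
is arbitrary. -/
def Space.position : D.Space → ℝ
  | .node _ => 0
  | .inner _ t => t

theorem IsBasicOpen.isOpen {U : Set D.Space} (hU : D.IsBasicOpen U) : IsOpen U :=
  TopologicalSpace.isOpen_generateFrom_of_mem hU

theorem le_nhds_of_isBasicOpen {F : Filter D.Space} {p : D.Space}
    (h : ∀ U, D.IsBasicOpen U → p ∈ U → U ∈ F) : F ≤ 𝓝 p := by
  rw [TopologicalSpace.nhds_generateFrom]
  exact le_iInf₂ fun U hU => le_principal_iff.2 (h U hU.2 hU.1)

theorem node_notMem_edgeBall {e : D.Edge} {z ε : ℝ} {x : D.Node} :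
    Space.node x ∉ edgeBall e z ε := by
  rintro ⟨t, h, -⟩
  cases h

theorem node_notMem_bundleBalls {A B : Set D.Node} {z ε : ℝ} {x : D.Node} :
    Space.node x ∉ bundleBalls A B z ε := by
  rintro ⟨e, -, -, h⟩
  exact node_notMem_edgeBall h

theorem inner_mem_edgeBall {e e' : D.Edge} {z ε : ℝ} {t : Set.Ioo (0 : ℝ) 1} :
    Space.inner e t ∈ edgeBall e' z ε ↔ e = e' ∧ |(t : ℝ) - z| < ε := by
  constructor
  · rintro ⟨t', h, ht⟩
    cases h
    exact ⟨rfl, ht⟩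
  · rintro ⟨rfl, h⟩
    exact ⟨t, rfl, h⟩

theorem inner_mem_bundleBalls {A B : Set D.Node} {e : D.Edge} {z ε : ℝ}
    {t : Set.Ioo (0 : ℝ) 1} : Space.inner e t ∈ bundleBalls A B z ε ↔
      e.tail ∈ A ∧ e.head ∈ B ∧ |(t : ℝ) - z| < ε := by
  constructor
  · rintro ⟨e', hA, hB, h⟩
    obtain ⟨rfl, ht⟩ := inner_mem_edgeBall.1 h
    exact ⟨hA, hB, ht⟩
  · rintro ⟨hA, hB, h⟩
    exact ⟨e, hA, hB, inner_mem_edgeBall.2 ⟨rfl, h⟩⟩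

/-- Only stars and sets `Ĉ_ε(X, ω)` have to be considered for convergence to a vertex or end. -/
theorem le_nhds_node {F : Filter D.Space} {x : D.Node}
    (hstar : ∀ v ε, 0 < ε → x = .vert v → star v ε ∈ F)
    (hend : ∀ X ω ε, 0 < ε → x ∈ nodesIn X (D.endComp X ω) → endNhd X ω ε ∈ F) :
    F ≤ 𝓝 (Space.node x) := by
  refine le_nhds_of_isBasicOpen fun U hU hx => ?_
  cases hU with
  | vertex v ε hε => exact hstar v ε hε hx
  | atEnd X ω ε hε => exact hend X ω ε hε hx
  | edge => exact absurd hx node_notMem_edgeBall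
  | endEnd => exact absurd hx node_notMem_bundleBalls
  | vertexEnd => exact absurd hx node_notMem_bundleBalls
  | endVertex => exact absurd hx node_notMem_bundleBalls

theorem edge_ext {e e' : D.Edge} (ht : e.tail = e'.tail) (hh : e.head = e'.head) : e = e' := by
  cases e; cases e'; cases ht; cases hh; rfl

/-- Convergence to an inner point `inner e s` follows from convergence of the tails, the heads and
the positions to the tail of `e`, the head of `e` and `s`. -/
theorem le_nhds_inner {F : Ultrafilter D.Space}
    (hF : ∀ᶠ p : D.Space in F, ∃ e t, p = Space.inner e t)
    {e : D.Edge} {s : Set.Ioo (0 : ℝ) 1} (htail : NodeLimit (F.map Space.tail) e.tail)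
    (hhead : NodeLimit (F.map Space.head) e.head)
    (hpos : Tendsto Space.position (F : Filter D.Space) (𝓝 (s : ℝ))) :
    (F : Filter D.Space) ≤ 𝓝 (Space.inner e s) := by
  have htV : ∀ v, e.tail = .vert v → ∀ᶠ p : D.Space in F, p.tail = .vert v := htail.vert
  have hhV : ∀ v, e.head = .vert v → ∀ᶠ p : D.Space in F, p.head = .vert v := hhead.vert
  have htC : ∀ X ω, e.tail ∈ nodesIn X (D.endComp X ω) →
      ∀ᶠ p : D.Space in F, p.tail ∈ nodesIn X (D.endComp X ω) :=
    fun X ω => htail.comp X _ (D.isStrongComp_endComp X ω)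
  have hhC : ∀ X ω, e.head ∈ nodesIn X (D.endComp X ω) →
      ∀ᶠ p : D.Space in F, p.head ∈ nodesIn X (D.endComp X ω) :=
    fun X ω => hhead.comp X _ (D.isStrongComp_endComp X ω)
  have hlt : ∀ c, (s : ℝ) < c → ∀ᶠ p : D.Space in F, p.position < c := fun c hc =>
    hpos.eventually (gt_mem_nhds hc)
  have hgt : ∀ c, c < (s : ℝ) → ∀ᶠ p : D.Space in F, c < p.position := fun c hc =>
    hpos.eventually (lt_mem_nhds hc)
  have hball : ∀ z ε, |(s : ℝ) - z| < ε → ∀ᶠ p : D.Space in F, |p.position - z| < ε := by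
    intro z ε h
    have hc : Continuous fun t : ℝ => |t - z| := by fun_prop
    exact (hc.continuousAt.tendsto.comp hpos).eventually (gt_mem_nhds h)
  refine le_nhds_of_isBasicOpen fun U hU hp => ?_
  cases hU with
  | vertex v ε hε =>
    rcases hp with ⟨hv, hs⟩ | ⟨hv, hs⟩
    · filter_upwards [hF, htV v hv, hlt ε hs]
      rintro _ ⟨e', t, rfl⟩ h1 h2
      exact .inl ⟨h1, h2⟩
    · filter_upwards [hF, hhV v hv, hgt _ hs]
      rintro _ ⟨e', t, rfl⟩ h1 h2
      exact .inr ⟨h1, h2⟩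
  | edge e' v w hv hw z ε =>
    obtain ⟨rfl, hs⟩ := inner_mem_edgeBall.1 hp
    filter_upwards [hF, htV v hv, hhV w hw, hball z ε hs]
    rintro _ ⟨e', t, rfl⟩ h1 h2 h3
    exact inner_mem_edgeBall.2 ⟨edge_ext (h1.trans hv.symm) (h2.trans hw.symm), h3⟩
  | atEnd X ω ε hε =>
    rcases hp with ⟨h, h'⟩ | ⟨h, hs⟩ | ⟨h, hs⟩
    · filter_upwards [hF, htC X ω h, hhC X ω h']
      rintro _ ⟨e', t, rfl⟩ h1 h2
      exact .inl ⟨h1, h2⟩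
    · filter_upwards [hF, htC X ω h, hlt ε hs]
      rintro _ ⟨e', t, rfl⟩ h1 h2
      exact .inr (.inl ⟨h1, h2⟩)
    · filter_upwards [hF, hhC X ω h, hgt _ hs]
      rintro _ ⟨e', t, rfl⟩ h1 h2
      exact .inr (.inr ⟨h1, h2⟩)
  | endEnd ω η hl X hX z ε =>
    obtain ⟨h, h', hs⟩ := inner_mem_bundleBalls.1 hp
    filter_upwards [hF, htC X ω h, hhC X η h', hball z ε hs]
    rintro _ ⟨e', t, rfl⟩ h1 h2 h3
    exact inner_mem_bundleBalls.2 ⟨h1, h2, h3⟩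
  | vertexEnd v ω hl X hX z ε =>
    obtain ⟨h, h', hs⟩ := inner_mem_bundleBalls.1 hp
    filter_upwards [hF, htV v h, hhC X ω h', hball z ε hs]
    rintro _ ⟨e', t, rfl⟩ h1 h2 h3
    exact inner_mem_bundleBalls.2 ⟨h1, h2, h3⟩
  | endVertex ω v hl X hX z ε =>
    obtain ⟨h, h', hs⟩ := inner_mem_bundleBalls.1 hp
    filter_upwards [hF, htC X ω h, hhV v h', hball z ε hs]
    rintro _ ⟨e', t, rfl⟩ h1 h2 h3
    exact inner_mem_bundleBalls.2 ⟨h1, h2, h3⟩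

theorem IsSolid.compactSpace (hloop : ∀ v : V, ¬ D.Adj v v) (hD : D.IsSolid) :
    CompactSpace D.Space := by
  refine isCompact_univ_iff.1 (isCompact_iff_ultrafilter_le_nhds.2 fun F _ => ?_)
  obtain ⟨x, hx⟩ := hD.exists_nodeLimit (F.map Space.tail)
  obtain ⟨y, hy⟩ := hD.exists_nodeLimit (F.map Space.head)
  have htV : ∀ v, x = .vert v → ∀ᶠ p : D.Space in F, p.tail = .vert v := hx.vert
  have hhV : ∀ v, y = .vert v → ∀ᶠ p : D.Space in F, p.head = .vert v := hy.vert
  have htC : ∀ X ω, x ∈ nodesIn X (D.endComp X ω) →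
      ∀ᶠ p : D.Space in F, p.tail ∈ nodesIn X (D.endComp X ω) :=
    fun X ω => hx.comp X _ (D.isStrongComp_endComp X ω)
  have hhC : ∀ X ω, y ∈ nodesIn X (D.endComp X ω) →
      ∀ᶠ p : D.Space in F, p.head ∈ nodesIn X (D.endComp X ω) :=
    fun X ω => hy.comp X _ (D.isStrongComp_endComp X ω)
  by_cases hF : ∀ᶠ p : D.Space in F, ∃ e t, p = Space.inner e t
  swap
  · -- The ultrafilter lives on the vertices and ends.
    have hF : ∀ᶠ p : D.Space in F, ¬ ∃ e t, p = Space.inner e t := Ultrafilter.eventually_not.2 hF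
    refine ⟨.node x, trivial, le_nhds_node (fun v ε _ hv => ?_) fun X ω ε _ hω => ?_⟩
    · filter_upwards [hF, htV v hv]
      rintro (p | ⟨e, t⟩) h1 h2
      exacts [h2, absurd ⟨e, t, rfl⟩ h1]
    · filter_upwards [hF, htC X ω hω]
      rintro (p | ⟨e, t⟩) h1 h2
      exacts [h2, absurd ⟨e, t, rfl⟩ h1]
  have hIcc : Set.Icc (0 : ℝ) 1 ∈ F.map Space.position := by
    change ∀ᶠ p : D.Space in F, p.position ∈ Set.Icc (0 : ℝ) 1
    filter_upwards [hF]
    rintro _ ⟨e, t, rfl⟩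
    exact ⟨t.2.1.le, t.2.2.le⟩
  obtain ⟨s, hs, hpos⟩ := isCompact_Icc.ultrafilter_le_nhds' (F.map Space.position) hIcc
  replace hpos : Tendsto Space.position (F : Filter D.Space) (𝓝 s) := hpos
  have hlt : ∀ c, s < c → ∀ᶠ p : D.Space in F, p.position < c := fun c hc =>
    hpos.eventually (gt_mem_nhds hc)
  have hgt : ∀ c, c < s → ∀ᶠ p : D.Space in F, c < p.position := fun c hc =>
    hpos.eventually (lt_mem_nhds hc)
  rcases hs.1.eq_or_lt with rfl | hs0
  · -- Positions converging to `0`: convergence to the limit of the tails.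
    refine ⟨.node x, trivial, le_nhds_node (fun v ε hε hv => ?_) fun X ω ε hε hω => ?_⟩
    · filter_upwards [hF, htV v hv, hlt ε hε]
      rintro _ ⟨e', t, rfl⟩ h1 h2
      exact .inl ⟨h1, h2⟩
    · filter_upwards [hF, htC X ω hω, hlt ε hε]
      rintro _ ⟨e', t, rfl⟩ h1 h2
      exact .inr (.inl ⟨h1, h2⟩)
  rcases hs.2.eq_or_lt with rfl | hs1
  · -- Positions converging to `1`: convergence to the limit of the heads.
    refine ⟨.node y, trivial, le_nhds_node (fun v ε hε hv => ?_) fun X ω ε hε hω => ?_⟩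
    · filter_upwards [hF, hhV v hv, hgt (1 - ε) (by linarith)]
      rintro _ ⟨e', t, rfl⟩ h1 h2
      exact .inr ⟨h1, h2⟩
    · filter_upwards [hF, hhC X ω hω, hgt (1 - ε) (by linarith)]
      rintro _ ⟨e', t, rfl⟩ h1 h2
      exact .inr (.inr ⟨h1, h2⟩)
  by_cases hxy : x = y
  · -- Tails and heads with the same limit: as there are no loops, this limit is an end, and
    -- eventually both ends of the edges are in the same strong component.
    subst hxy
    refine ⟨.node x, trivial, le_nhds_node (fun v ε hε hv => ?_) fun X ω ε hε hω => ?_⟩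
    · filter_upwards [hF, htV v hv, hhV v hv]
      rintro _ ⟨⟨a, b, he⟩, t, rfl⟩ h1 h2
      obtain rfl : a = .vert v := h1
      obtain rfl : b = .vert v := h2
      exact absurd he (hloop v)
    · filter_upwards [hF, htC X ω hω, hhC X ω hω]
      rintro _ ⟨e', t, rfl⟩ h1 h2
      exact .inl ⟨h1, h2⟩
  · have he : D.IsEdge x y := by
      refine hx.isEdge hy hxy fun A hA B hB => ?_
      have hA' : ∀ᶠ p : D.Space in F, p.tail ∈ A := hA
      have hB' : ∀ᶠ p : D.Space in F, p.head ∈ B := hB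
      obtain ⟨_, ⟨e, t, rfl⟩, h1, h2⟩ := (hF.and (hA'.and hB')).exists
      exact ⟨e, h1, h2⟩
    exact ⟨.inner ⟨x, y, he⟩ ⟨s, hs0, hs1⟩, trivial, le_nhds_inner hF hx hy hpos⟩

end Compact

/-! ### Solidity of a digraph with compact space -/

section Solid

universe u

variable {V : Type u} {D : Digraph V}

/-- Every inner point has a neighbourhood that contains no vertex and no end. -/
theorem exists_nhds_inner (e : D.Edge) (t : Set.Ioo (0 : ℝ) 1) :
    ∃ U ∈ 𝓝 (Space.inner e t), ∀ x : D.Node, Space.node x ∉ U := by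
  have hpos : 0 < min (t : ℝ) (1 - t) := lt_min t.2.1 (sub_pos.2 t.2.2)
  have h0 : min (t : ℝ) (1 - t) ≤ t := min_le_left _ _
  have h1 : min (t : ℝ) (1 - t) ≤ 1 - t := min_le_right _ _
  have hball : |(t : ℝ) - t| < min (t : ℝ) (1 - t) := by simpa using hpos
  obtain ⟨x, y, he⟩ := e
  rcases x with v | ω <;> rcases y with w | η
  · exact ⟨_, (IsBasicOpen.edge ⟨_, _, he⟩ v w rfl rfl t _ hpos h0 h1).isOpen.mem_nhds
      (inner_mem_edgeBall.2 ⟨rfl, hball⟩), fun _ => node_notMem_edgeBall⟩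
  · exact ⟨_, (IsBasicOpen.vertexEnd v η he {v} (by simp) t _ hpos h0 h1).isOpen.mem_nhds
      (inner_mem_bundleBalls.2 ⟨rfl, rfl, hball⟩), fun _ => node_notMem_bundleBalls⟩
  · exact ⟨_, (IsBasicOpen.endVertex ω w he {w} (by simp) t _ hpos h0 h1).isOpen.mem_nhds
      (inner_mem_bundleBalls.2 ⟨rfl, rfl, hball⟩), fun _ => node_notMem_bundleBalls⟩
  · obtain ⟨X, hX⟩ := exists_endComp_ne he.1
    exact ⟨_, (IsBasicOpen.endEnd ω η he X hX t _ hpos h0 h1).isOpen.mem_nhds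
      (inner_mem_bundleBalls.2 ⟨rfl, rfl, hball⟩), fun _ => node_notMem_bundleBalls⟩

/-- Every point of `|D|` has a neighbourhood that meets at most one strong component
of `D - X`. -/
theorem exists_nhds_subset_strongComp (X : Finset V) (p : D.Space) :
    ∃ U ∈ 𝓝 p, {C | D.IsStrongComp X C ∧ ∃ v ∈ C, Space.node (.vert v) ∈ U}.Subsingleton := by
  rcases p with (v | ω) | ⟨e, t⟩
  · refine ⟨_, (IsBasicOpen.vertex v 1 one_pos le_rfl).isOpen.mem_nhds rfl, ?_⟩
    rintro C ⟨hC, a, haC, ha⟩ C' ⟨hC', b, hbC, hb⟩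
    obtain rfl : a = v := Node.vert.inj ha
    obtain rfl : b = a := Node.vert.inj hb
    exact hC.eq_of_mem D hC' haC hbC
  · refine ⟨_, (IsBasicOpen.atEnd X ω 1 one_pos le_rfl).isOpen.mem_nhds rfl, ?_⟩
    rintro C ⟨hC, a, haC, ha⟩ C' ⟨hC', b, hbC, hb⟩
    rw [hC.eq_of_mem D (D.isStrongComp_endComp X ω) haC ha,
      hC'.eq_of_mem D (D.isStrongComp_endComp X ω) hbC hb]
  · obtain ⟨U, hU, h⟩ := exists_nhds_inner e t
    refine ⟨U, hU, ?_⟩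
    rintro C ⟨-, a, -, ha⟩
    exact absurd ha (h _)

theorem isSolid_of_compactSpace [CompactSpace D.Space] : D.IsSolid := by
  intro X
  choose U hU hsub using exists_nhds_subset_strongComp (D := D) X
  obtain ⟨T, -, hT⟩ := isCompact_univ.elim_nhds_subcover U fun p _ => hU p
  refine (T.finite_toSet.biUnion fun p _ => (hsub p).finite).subset fun C hC => ?_
  obtain ⟨v, hv⟩ := IsStrongComp.nonempty hC
  obtain ⟨p, hp, hvp⟩ := Set.mem_iUnion₂.1 (hT (Set.mem_univ (Space.node (.vert v))))
  exact Set.mem_biUnion hp ⟨hC, v, hv, hvp⟩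

end Solid

end Digraph

theorem mainTheorem1 {V : Type*} (D : Digraph V) (hD : ∀ v : V, ¬ D.Adj v v) :
    CompactSpace D.Space ↔ D.IsSolid := by
  exact ⟨fun _ => Digraph.isSolid_of_compactSpace, fun h => h.compactSpace hD⟩
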